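/- Let $V$ be an $n$-dimensional complex inner product space, and let $W\subseteq U(V)$ be a finite unitary reflection group, that is, a finite group of unitary transformations of $V$ generated by reflections (elements whose space of fixed vectors is a hyperplane of $V$). Let $x_1,\dots,x_n$ be an orthonormal basis of the dual space $V^*$, let $S=S(V^*)=\mathbb{C}[x_1,\dots,x_n]$ with the action $(w\cdot f)(v)=f(w^{-1}v)$ of $W$, and let $R=S^W$ be the algebra of invariants. A system of basic invariants is a system of $n$ algebraically independent homogeneous polynomials that generate the algebra $R$. For $f=\sum_{a}c_a x^a\in S$ let $f^*=\sum_a\overline{c_a}\,\partial^a$, a differential operator on $S$, where $\partial^a=\partial_1^{a_1}\cdots\partial_n^{a_n}$ and $\partial_i=\partial/\partial x_i$. Then $W$ has a canonical system of basic invariants: there is a system of basic invariants $f_1,\dots,f_n$ such that $$f_i^*f_j=\delta_{ij}\qquad(i,j=1,\dots,n).$$ -/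

import Mathlib

open MvPolynomial

namespace UnitaryReflection

variable {V : Type*} [NormedAddCommGroup V] [InnerProductSpace ℂ V] {n : ℕ}

/-- A unitary transformation is a reflection if the space of its fixed vectors is a hyperplane,
that is, a subspace of codimension one. -/
def IsReflection (s : V ≃ₗᵢ[ℂ] V) : Prop :=
  Module.finrank ℂ (LinearMap.ker (s.toLinearEquiv.toLinearMap - LinearMap.id)) + 1 =
    Module.finrank ℂ V

/-- A group of unitary transformations is a reflection group if it is generated by the
reflections that it contains. -/
def IsReflectionGroup (W : Subgroup (V ≃ₗᵢ[ℂ] V)) : Prop :=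
  Subgroup.closure {s : V ≃ₗᵢ[ℂ] V | s ∈ W ∧ IsReflection s} = W

/-- An orthonormal basis `b` of `V` has as dual basis the coordinate functions
`x i = fun v => b.repr v i`, an orthonormal basis of the dual space of `V`, and the symmetric
algebra of the dual space is the polynomial algebra in the `x i`.
This is the contragredient action of a unitary transformation `w` on that algebra: the variable
`x j` goes to the linear form `v ↦ x j (w⁻¹ v)`. -/
noncomputable def act (b : OrthonormalBasis (Fin n) ℂ V) (w : V ≃ₗᵢ[ℂ] V) :
    MvPolynomial (Fin n) ℂ →ₐ[ℂ] MvPolynomial (Fin n) ℂ :=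
  aeval fun j => ∑ k, C (b.repr (w⁻¹ (b k)) j) * X k

/-- The action is `(w • f)(v) = f(w⁻¹ v)`. -/
theorem eval_act (b : OrthonormalBasis (Fin n) ℂ V) (w : V ≃ₗᵢ[ℂ] V)
    (f : MvPolynomial (Fin n) ℂ) (v : V) :
    eval (fun i => b.repr v i) (act b w f) = eval (fun i => b.repr (w⁻¹ v) i) f := by
  have key : ∀ j, eval (fun i => b.repr v i)
      (∑ k, C (b.repr (w⁻¹ (b k)) j) * X k : MvPolynomial (Fin n) ℂ) = b.repr (w⁻¹ v) j := by
    intro j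
    have h : b.repr (w⁻¹ v) = ∑ k, b.repr v k • b.repr (w⁻¹ (b k)) := by
      conv_lhs => rw [← b.sum_repr v]
      simp
    rw [h]
    simp [mul_comm]
  induction f using MvPolynomial.induction_on with
  | C a => simp [act]
  | add p q hp hq => simp only [map_add, hp, hq]
  | mul_X p j hp =>
    rw [map_mul, map_mul, hp, map_mul, eval_X]
    congr 1
    rw [act, aeval_X, key]

/-- The algebra of `W`-invariant polynomials. -/
noncomputable def invariants (b : OrthonormalBasis (Fin n) ℂ V) (W : Subgroup (V ≃ₗᵢ[ℂ] V)) :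
    Subalgebra ℂ (MvPolynomial (Fin n) ℂ) where
  carrier := {f | ∀ w ∈ W, act b w f = f}
  mul_mem' := fun hf hg w hw => by rw [map_mul, hf w hw, hg w hw]
  add_mem' := fun hf hg w hw => by rw [map_add, hf w hw, hg w hw]
  algebraMap_mem' := fun c w _ => (act b w).commutes c

/-- A system of basic invariants: `n = dim V` algebraically independent homogeneous polynomials
that generate the algebra of invariants. -/
structure IsBasicInvariants (b : OrthonormalBasis (Fin n) ℂ V) (W : Subgroup (V ≃ₗᵢ[ℂ] V))
    (f : Fin n → MvPolynomial (Fin n) ℂ) : Prop where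
  homogeneous : ∀ i, ∃ m : ℕ, (f i).IsHomogeneous m
  algebraicIndependent : AlgebraicIndependent ℂ f
  generate : Algebra.adjoin ℂ (Set.range f) = invariants b W

/-- The operator `∂^a = ∂_1 ^ a_1 ∘ ⋯ ∘ ∂_n ^ a_n` on polynomials. -/
noncomputable def partialPow (a : Fin n →₀ ℕ) : Module.End ℂ (MvPolynomial (Fin n) ℂ) :=
  (List.ofFn fun i : Fin n =>
    ((pderiv i).toLinearMap : Module.End ℂ (MvPolynomial (Fin n) ℂ)) ^ a i).prod

/-- For `f = ∑ c_a x^a`, the differential operator `f^* = ∑ conj(c_a) ∂^a`. -/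
noncomputable def starOp (f : MvPolynomial (Fin n) ℂ) :
    Module.End ℂ (MvPolynomial (Fin n) ℂ) :=
  ∑ a ∈ f.support, (starRingEnd ℂ) (coeff a f) • partialPow a

/-- A canonical system: basic invariants with `f_i^* f_j = δ_ij`. -/
structure IsCanonicalSystem (b : OrthonormalBasis (Fin n) ℂ V) (W : Subgroup (V ≃ₗᵢ[ℂ] V))
    (f : Fin n → MvPolynomial (Fin n) ℂ) : Prop where
  basic : IsBasicInvariants b W f
  orthonormal : ∀ i j, starOp (f i) (f j) = if i = j then 1 else 0

end UnitaryReflection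

/-!
# Canonical systems of basic invariants of unitary reflection groups

Let `S` be the polynomial algebra, `R` the algebra of invariants and `R₊` the space of invariants
without constant term. The elements of `R₊ * R₊` are called decomposable.

The apolar inner product `⟪f, g⟫ = ∑ a, conj (f_a) * g_a * a!` on `S` is positive definite
(`apolarCore`), invariant under unitary transformations (`apolar_act`), and multiplication by `f`
is adjoint to the differential operator `f^*` (`apolar_mul_left`). In each degree choose an
orthonormal basis of the orthogonal complement of the decomposables in `R₊`
(`exists_orthonormal_indecomposables`). The union of these bases is a canonical system.

* It is canonical: for `p` without constant term, `⟪p, f_i^* f_j⟫ = ⟪f_i p, f_j⟫`, and averaging over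
  the group replaces `f_i p` by a decomposable invariant, which is orthogonal to `f_j`. So
  `f_i^* f_j` is the constant `⟪f_i, f_j⟫` (`starOp_eq_C_of_orthogonal`).
* It generates `R`, by induction on the degree (`adjoin_eq_invariants`).
* It is algebraically independent, being linearly independent modulo decomposables
  (`algebraicIndependent_of_linearIndependent_mod`). This is Chevalley's theorem, and the only place
  where reflections are used: a reflection `s` admits divided differences `(s • f - f) / ℓ_s`, which
  lower the degree of a relation with invariant coefficients (`sum_smul_mem_coinvariantIdeal`).
  Chevalley's argument picks a minimal system of generators of the ideal of `R` generated by the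
  partial derivatives of a relation. Here a functional `φ` on that ideal modulo its product with
  the maximal ideal `R₊` takes over this role; it exists by Nakayama's lemma
  (`exists_functional`), and no grading of the relations is needed.
* It has `n` elements: `S` is integral over `R` (`isIntegral_invariants`), so the system is a
  transcendence basis of `S`, like the `n` variables.
-/

namespace UnitaryReflection

/-! ### The apolar inner product on polynomials -/

section Apolar

variable {n : ℕ}

/-- The weight `a! = ∏ i, (a i)!` of a multi-index, as a complex number. -/
noncomputable def multiFactorial (a : Fin n →₀ ℕ) : ℂ := ∏ i, ((a i).factorial : ℂ)

/-- The apolar inner product `⟪f, g⟫ = ∑ a, conj (f_a) * g_a * a!`, conjugate linear in `f`; it is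
the constant term of `f^* g`. -/
noncomputable def apolar (f g : MvPolynomial (Fin n) ℂ) : ℂ :=
  ∑ a ∈ g.support, (starRingEnd ℂ) (coeff a f) * coeff a g * multiFactorial a

theorem apolar_eq_sum_of_support_right_subset (f g : MvPolynomial (Fin n) ℂ)
    (s : Finset (Fin n →₀ ℕ)) (hs : g.support ⊆ s) :
    apolar f g = ∑ a ∈ s, (starRingEnd ℂ) (coeff a f) * coeff a g * multiFactorial a := by
  refine Finset.sum_subset hs fun a _ ha => ?_
  rw [notMem_support_iff.1 ha]
  simp

theorem apolar_eq_sum_of_support_left_subset (f g : MvPolynomial (Fin n) ℂ)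
    (s : Finset (Fin n →₀ ℕ)) (hs : f.support ⊆ s) :
    apolar f g = ∑ a ∈ s, (starRingEnd ℂ) (coeff a f) * coeff a g * multiFactorial a := by
  classical
  rw [apolar_eq_sum_of_support_right_subset f g (g.support ∪ s) Finset.subset_union_left]
  refine (Finset.sum_subset Finset.subset_union_right fun a _ ha => ?_).symm
  rw [notMem_support_iff.1 fun h => ha (hs h)]
  simp

theorem apolar_add_left (f g h : MvPolynomial (Fin n) ℂ) :
    apolar (f + g) h = apolar f h + apolar g h := by
  simp [apolar, ← Finset.sum_add_distrib, add_mul]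

theorem apolar_add_right (f g h : MvPolynomial (Fin n) ℂ) :
    apolar f (g + h) = apolar f g + apolar f h := by
  rw [apolar_eq_sum_of_support_left_subset f _ _ subset_rfl,
    apolar_eq_sum_of_support_left_subset f g _ subset_rfl,
    apolar_eq_sum_of_support_left_subset f h _ subset_rfl, ← Finset.sum_add_distrib]
  exact Finset.sum_congr rfl fun a _ => by rw [coeff_add]; ring

theorem apolar_smul_left (c : ℂ) (f g : MvPolynomial (Fin n) ℂ) :
    apolar (c • f) g = (starRingEnd ℂ) c * apolar f g := by
  simp [apolar, Finset.mul_sum, mul_assoc]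

theorem apolar_smul_right (c : ℂ) (f g : MvPolynomial (Fin n) ℂ) :
    apolar f (c • g) = c * apolar f g := by
  rw [apolar_eq_sum_of_support_left_subset f _ _ subset_rfl,
    apolar_eq_sum_of_support_left_subset f g _ subset_rfl, Finset.mul_sum]
  exact Finset.sum_congr rfl fun a _ => by rw [coeff_smul, smul_eq_mul]; ring

/-- The apolar inner product as a sesquilinear map. -/
noncomputable def apolarForm :
    MvPolynomial (Fin n) ℂ →ₗ⋆[ℂ] MvPolynomial (Fin n) ℂ →ₗ[ℂ] ℂ :=
  LinearMap.mk₂'ₛₗ (starRingEnd ℂ) (RingHom.id ℂ) apolar apolar_add_left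
    (fun c f g => by rw [apolar_smul_left]; rfl) apolar_add_right
    (fun c f g => by rw [apolar_smul_right]; rfl)

@[simp]
theorem apolarForm_apply (f g : MvPolynomial (Fin n) ℂ) : apolarForm f g = apolar f g := rfl

theorem apolar_C_left (c : ℂ) (g : MvPolynomial (Fin n) ℂ) :
    apolar (C c) g = (starRingEnd ℂ) c * constantCoeff g := by
  rw [apolar_eq_sum_of_support_left_subset (C c) g {0} (by
    simpa only [C_apply] using support_monomial_subset)]
  simp [multiFactorial, constantCoeff_eq]

theorem conj_apolar (f g : MvPolynomial (Fin n) ℂ) :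
    (starRingEnd ℂ) (apolar g f) = apolar f g := by
  rw [apolar_eq_sum_of_support_left_subset f g _ subset_rfl, apolar, map_sum]
  exact Finset.sum_congr rfl fun a _ => by simp [multiFactorial, mul_comm]

theorem apolar_self (f : MvPolynomial (Fin n) ℂ) :
    apolar f f = ((∑ a ∈ f.support, ‖coeff a f‖ ^ 2 * ∏ i, ((a i).factorial : ℝ) : ℝ) : ℂ) := by
  rw [apolar]
  push_cast
  refine Finset.sum_congr rfl fun a _ => ?_
  rw [multiFactorial, Complex.conj_mul']

theorem eq_zero_of_apolar_self_eq_zero (f : MvPolynomial (Fin n) ℂ) (hf : apolar f f = 0) :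
    f = 0 := by
  rw [apolar_self, Complex.ofReal_eq_zero, Finset.sum_eq_zero_iff_of_nonneg fun a _ => by
    positivity] at hf
  by_contra hne
  obtain ⟨a, ha⟩ := Finset.nonempty_iff_ne_empty.2 (mt support_eq_empty.1 hne)
  have h : 0 < ‖coeff a f‖ := norm_pos_iff.2 (mem_support_iff.1 ha)
  have h2 : 0 < ‖coeff a f‖ ^ 2 * ∏ i, ((a i).factorial : ℝ) := by positivity
  exact h2.ne' (hf a ha)

/-- The apolar inner product satisfies the axioms of a complex inner product. -/
@[reducible]
noncomputable def apolarCore (n : ℕ) : InnerProductSpace.Core ℂ (MvPolynomial (Fin n) ℂ) where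
  inner := apolar
  conj_inner_symm := conj_apolar
  re_inner_nonneg f := by
    rw [apolar_self, RCLike.re_eq_complex_re, Complex.ofReal_re]
    positivity
  add_left := apolar_add_left
  smul_left f g c := apolar_smul_left c f g
  definite := eq_zero_of_apolar_self_eq_zero

/-- Multiplication by `X j` is adjoint to `∂_j`. -/
theorem apolar_X_mul (j : Fin n) (g h : MvPolynomial (Fin n) ℂ) :
    apolar (X j * g) h = apolar g (pderiv j h) := by
  induction g using MvPolynomial.induction_on' with
  | monomial a c =>
    have e : X j * monomial a c = monomial (a + Finsupp.single j 1) c := by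
      rw [mul_comm, X, monomial_mul, mul_one]
    rw [e, apolar_eq_sum_of_support_left_subset _ h _ support_monomial_subset,
      apolar_eq_sum_of_support_left_subset _ (pderiv j h) _ support_monomial_subset]
    have hf : multiFactorial (a + Finsupp.single j 1) = ((a j : ℂ) + 1) * multiFactorial a := by
      rw [multiFactorial, multiFactorial, ← Finset.mul_prod_erase _ _ (Finset.mem_univ j),
        ← Finset.mul_prod_erase (f := fun i => ((a i).factorial : ℂ)) _ (Finset.mem_univ j),
        ← mul_assoc]
      congr 1
      · simp [Nat.factorial_succ]
      · refine Finset.prod_congr rfl fun i hi => ?_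
        simp [Finsupp.single_eq_of_ne (Finset.ne_of_mem_erase hi)]
    simp only [Finset.sum_singleton, coeff_monomial, if_true, coeff_pderiv, hf]
    ring
  | add p q hp hq => rw [mul_add, apolar_add_left, apolar_add_left, hp, hq]

theorem apolar_list_prod_mul {ι : Type*} (l : List ι) (u : ι → MvPolynomial (Fin n) ℂ)
    (v : ι → Module.End ℂ (MvPolynomial (Fin n) ℂ))
    (huv : ∀ i g h, apolar (u i * g) h = apolar g (v i h)) (g h : MvPolynomial (Fin n) ℂ) :
    apolar ((l.map u).prod * g) h = apolar g ((l.map v).prod h) := by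
  induction l generalizing g with
  | nil => simp
  | cons i l ih =>
    rw [List.map_cons, List.map_cons, List.prod_cons, List.prod_cons, mul_comm (u i), mul_assoc,
      ih, huv, Module.End.mul_apply]

theorem apolar_monomial_mul (a : Fin n →₀ ℕ) (g h : MvPolynomial (Fin n) ℂ) :
    apolar (monomial a 1 * g) h = apolar g (partialPow a h) := by
  have hm : (monomial a 1 : MvPolynomial (Fin n) ℂ) =
      ((List.finRange n).map fun i => X i ^ a i).prod := by
    rw [monomial_eq, C_1, one_mul, Finsupp.prod_fintype _ _ fun i => pow_zero _,
      ← List.ofFn_eq_map, List.prod_ofFn]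
  rw [hm, partialPow, List.ofFn_eq_map]
  refine apolar_list_prod_mul _ _ _ (fun i g h => ?_) g h
  generalize a i = k
  induction k generalizing g h with
  | zero => simp
  | succ k ih =>
    rw [pow_succ, mul_assoc, ih, apolar_X_mul, pow_succ', Module.End.mul_apply]
    rfl

/-- Multiplication by `f` is adjoint to the differential operator `f^*`. -/
theorem apolar_mul_left (f g h : MvPolynomial (Fin n) ℂ) :
    apolar (f * g) h = apolar g (starOp f h) := by
  have hl : apolar (f * g) h =
      ∑ a ∈ f.support, (starRingEnd ℂ) (coeff a f) * apolar (monomial a 1 * g) h := by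
    conv_lhs => rw [f.as_sum, Finset.sum_mul, ← apolarForm_apply, map_sum, LinearMap.sum_apply]
    refine Finset.sum_congr rfl fun a _ => ?_
    rw [apolarForm_apply, ← apolar_smul_left, ← smul_mul_assoc, smul_monomial, smul_eq_mul, mul_one]
  rw [hl, starOp, LinearMap.sum_apply, ← apolarForm_apply, map_sum]
  refine Finset.sum_congr rfl fun a _ => ?_
  rw [apolar_monomial_mul, LinearMap.smul_apply, map_smul, smul_eq_mul, apolarForm_apply]

/-- Homogeneous components of different degrees are orthogonal. -/
theorem apolar_homogeneousComponent {d : ℕ} {f : MvPolynomial (Fin n) ℂ} (hf : f.IsHomogeneous d)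
    (g : MvPolynomial (Fin n) ℂ) : apolar f (homogeneousComponent d g) = apolar f g := by
  rw [apolar_eq_sum_of_support_left_subset f _ _ subset_rfl,
    apolar_eq_sum_of_support_left_subset f g _ subset_rfl]
  refine Finset.sum_congr rfl fun a ha => ?_
  rw [coeff_homogeneousComponent, if_pos]
  by_contra h
  exact mem_support_iff.1 ha (hf.coeff_eq_zero h)

end Apolar

/-- Inside a finite-dimensional subspace `M`, a subspace `Q` has an orthogonal complement, and this
has an orthonormal basis. -/
theorem exists_orthonormal_complement {E : Type*} [NormedAddCommGroup E] [InnerProductSpace ℂ E]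
    (M Q : Submodule ℂ E) [FiniteDimensional ℂ M] (hQ : Q ≤ M) :
    ∃ (m : ℕ) (e : Fin m → E), Orthonormal ℂ e ∧ (∀ i, e i ∈ M) ∧
      (∀ i, ∀ q ∈ Q, inner ℂ (e i) q = 0) ∧ M ≤ Q ⊔ Submodule.span ℂ (Set.range e) := by
  have : FiniteDimensional ℂ Q := Submodule.finiteDimensional_of_le hQ
  have : FiniteDimensional ℂ (M ⊓ Qᗮ : Submodule ℂ E) :=
    Submodule.finiteDimensional_of_le inf_le_left
  let e := stdOrthonormalBasis ℂ (M ⊓ Qᗮ : Submodule ℂ E)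
  refine ⟨_, fun i => (e i : E), e.orthonormal.comp_linearIsometry (Submodule.subtypeₗᵢ _),
    fun i => (e i).2.1, fun i q hq => (Submodule.mem_orthogonal' _ _).1 (e i).2.2 q hq, ?_⟩
  have hspan : Submodule.span ℂ (Set.range fun i => (e i : E)) = M ⊓ Qᗮ := by
    have h := congrArg (Submodule.map (M ⊓ Qᗮ).subtype) e.toBasis.span_eq
    rw [Submodule.map_span, ← Set.range_comp, Submodule.map_top, Submodule.range_subtype] at h
    simpa [Function.comp_def] using h
  rw [hspan]
  intro x hx
  have h1 := Submodule.starProjection_apply_mem Q x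
  exact Submodule.mem_sup.2 ⟨_, h1, x - Q.starProjection x, ⟨M.sub_mem hx (hQ h1),
    Submodule.sub_starProjection_mem_orthogonal x⟩, add_sub_cancel _ _⟩

/-! ### The action on polynomials and the Reynolds operator -/

section Action

variable {V : Type*} [NormedAddCommGroup V] [InnerProductSpace ℂ V] {n : ℕ}
  (b : OrthonormalBasis (Fin n) ℂ V)

theorem act_X (w : V ≃ₗᵢ[ℂ] V) (j : Fin n) :
    act b w (X j) = ∑ k, C (b.repr (w⁻¹ (b k)) j) * X k := by
  rw [act, aeval_X]

theorem act_C (w : V ≃ₗᵢ[ℂ] V) (c : ℂ) : act b w (C c) = C c := (act b w).commutes c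

theorem polynomial_ext {f g : MvPolynomial (Fin n) ℂ}
    (h : ∀ v, eval (fun i => b.repr v i) f = eval (fun i => b.repr v i) g) : f = g :=
  MvPolynomial.funext fun x => by
    simpa using h (b.repr.symm (WithLp.toLp 2 x))

theorem act_mul (w₁ w₂ : V ≃ₗᵢ[ℂ] V) (f : MvPolynomial (Fin n) ℂ) :
    act b (w₁ * w₂) f = act b w₁ (act b w₂ f) :=
  polynomial_ext b fun v => by rw [eval_act, eval_act, eval_act, mul_inv_rev]; rfl

theorem act_one (f : MvPolynomial (Fin n) ℂ) : act b 1 f = f :=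
  polynomial_ext b fun v => by rw [eval_act, inv_one]; rfl

theorem act_isHomogeneous (w : V ≃ₗᵢ[ℂ] V) {f : MvPolynomial (Fin n) ℂ} {d : ℕ}
    (hf : f.IsHomogeneous d) : (act b w f).IsHomogeneous d := by
  have h := hf.aeval (fun j => ∑ k, C (b.repr (w⁻¹ (b k)) j) * X k) (n := 1) fun j =>
    IsHomogeneous.sum _ _ _ fun k _ => isHomogeneous_C_mul_X _ _
  rwa [one_mul] at h

theorem homogeneousComponent_act (w : V ≃ₗᵢ[ℂ] V) (d : ℕ) (f : MvPolynomial (Fin n) ℂ) :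
    homogeneousComponent d (act b w f) = act b w (homogeneousComponent d f) := by
  conv_lhs => rw [← sum_homogeneousComponent f, map_sum, map_sum]
  have h : ∀ i, homogeneousComponent d (act b w (homogeneousComponent i f)) =
      if i = d then act b w (homogeneousComponent i f) else 0 := fun i => by
    rw [homogeneousComponent_of_mem
      (act_isHomogeneous b w (homogeneousComponent_isHomogeneous i f))]
    simp only [eq_comm]
  simp only [h, Finset.sum_ite_eq', Finset.mem_range]
  split_ifs with hd
  · rfl
  · rw [homogeneousComponent_eq_zero _ _ (by omega), map_zero]

theorem constantCoeff_act (w : V ≃ₗᵢ[ℂ] V) (f : MvPolynomial (Fin n) ℂ) :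
    constantCoeff (act b w f) = constantCoeff f := by
  have h := homogeneousComponent_act b w 0 f
  rw [homogeneousComponent_zero, homogeneousComponent_zero, act_C] at h
  exact C_injective _ _ h

theorem totalDegree_act_le (w : V ≃ₗᵢ[ℂ] V) (f : MvPolynomial (Fin n) ℂ) :
    (act b w f).totalDegree ≤ f.totalDegree := by
  conv_lhs => rw [← sum_homogeneousComponent f, map_sum]
  refine totalDegree_finsetSum_le fun i hi => ?_
  have h := (act_isHomogeneous b w (homogeneousComponent_isHomogeneous i f)).totalDegree_le
  have := Finset.mem_range.1 hi
  omega

/-- The matrix of a unitary transformation in an orthonormal basis is unitary. -/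
theorem sum_conj_repr_mul_repr (w : V ≃ₗᵢ[ℂ] V) (j l : Fin n) :
    ∑ k, (starRingEnd ℂ) (b.repr (w⁻¹ (b k)) j) * b.repr (w⁻¹ (b k)) l =
      if j = l then 1 else 0 := by
  have h : ∀ j k, b.repr (w⁻¹ (b k)) j = inner ℂ (w (b j)) (b k) := fun j k => by
    rw [b.repr_apply_apply, ← w.inner_map_map]
    congr 1
    exact w.apply_symm_apply _
  simp only [h, inner_conj_symm]
  rw [Finset.sum_congr rfl fun k _ => mul_comm _ _, b.sum_inner_mul_inner,
    w.inner_map_map, orthonormal_iff_ite.1 b.orthonormal]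
  simp only [eq_comm]

/-- Equivariance of `f ↦ f^*` on linear forms: `(w • x_j)^* (w • q) = w • (∂_j q)`. -/
theorem sum_conj_smul_pderiv_act (w : V ≃ₗᵢ[ℂ] V) (j : Fin n) (q : MvPolynomial (Fin n) ℂ) :
    ∑ k, C ((starRingEnd ℂ) (b.repr (w⁻¹ (b k)) j)) * pderiv k (act b w q) =
      act b w (pderiv j q) := by
  induction q using MvPolynomial.induction_on with
  | C a => simp
  | add p q hp hq => simp only [map_add, mul_add, Finset.sum_add_distrib, hp, hq]
  | mul_X p l hp =>
    have hX : ∑ k, C ((starRingEnd ℂ) (b.repr (w⁻¹ (b k)) j)) * pderiv k (act b w (X l)) =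
        if l = j then 1 else 0 := by
      have h : ∀ k, pderiv k (act b w (X l)) = C (b.repr (w⁻¹ (b k)) l) := fun k => by
        simp only [act_X, map_sum, pderiv_C_mul, pderiv_X, Pi.single_apply, mul_ite, mul_one,
          mul_zero]
        simp
      simp only [h, ← C_mul, ← map_sum, sum_conj_repr_mul_repr]
      rw [apply_ite C, C_1, C_0]
      simp only [eq_comm]
    have h : ∀ k, C ((starRingEnd ℂ) (b.repr (w⁻¹ (b k)) j)) * pderiv k (act b w (p * X l)) =
        (C ((starRingEnd ℂ) (b.repr (w⁻¹ (b k)) j)) * pderiv k (act b w p)) * act b w (X l) +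
        act b w p * (C ((starRingEnd ℂ) (b.repr (w⁻¹ (b k)) j)) * pderiv k (act b w (X l))) :=
      fun k => by rw [map_mul, pderiv_mul]; ring
    simp only [h, Finset.sum_add_distrib, ← Finset.sum_mul, ← Finset.mul_sum, hp, hX]
    rw [pderiv_mul, pderiv_X, map_add, map_mul, map_mul, Pi.single_apply]
    simp only [eq_comm]
    split_ifs <;> simp

theorem apolar_act (w : V ≃ₗᵢ[ℂ] V) (f g : MvPolynomial (Fin n) ℂ) :
    apolar (act b w f) (act b w g) = apolar f g := by
  induction f using MvPolynomial.induction_on generalizing g with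
  | C a => rw [act_C, apolar_C_left, apolar_C_left, constantCoeff_act]
  | add p q hp hq => rw [map_add, apolar_add_left, apolar_add_left, hp, hq]
  | mul_X p j hp =>
    rw [mul_comm p, apolar_X_mul, ← hp, ← sum_conj_smul_pderiv_act, map_mul, act_X,
      Finset.sum_mul, ← apolarForm_apply, ← apolarForm_apply, map_sum, map_sum,
      LinearMap.sum_apply]
    refine Finset.sum_congr rfl fun k _ => ?_
    rw [apolarForm_apply, apolarForm_apply, ← smul_eq_C_mul, ← smul_eq_C_mul, smul_mul_assoc,
      apolar_smul_left, apolar_smul_right, apolar_X_mul]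

variable (W : Subgroup (V ≃ₗᵢ[ℂ] V))

theorem mem_invariants {f : MvPolynomial (Fin n) ℂ} :
    f ∈ invariants b W ↔ ∀ w ∈ W, act b w f = f := Iff.rfl

theorem homogeneousComponent_mem_invariants (d : ℕ) {f : MvPolynomial (Fin n) ℂ}
    (hf : f ∈ invariants b W) : homogeneousComponent d f ∈ invariants b W := fun w hw => by
  rw [← homogeneousComponent_act, hf w hw]

/-- The invariants without constant term, as a subspace of the polynomial algebra. -/
noncomputable def positiveInvariants : Submodule ℂ (MvPolynomial (Fin n) ℂ) where
  carrier := {f | f ∈ invariants b W ∧ constantCoeff f = 0}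
  add_mem' := fun hf hg => ⟨add_mem hf.1 hg.1, by rw [map_add, hf.2, hg.2, add_zero]⟩
  zero_mem' := ⟨zero_mem _, map_zero _⟩
  smul_mem' := fun c f hf => ⟨Subalgebra.smul_mem _ hf.1 c, by simp [hf.2]⟩

theorem homogeneousComponent_mem_positiveInvariants (d : ℕ) {f : MvPolynomial (Fin n) ℂ}
    (hf : f ∈ positiveInvariants b W) : homogeneousComponent d f ∈ positiveInvariants b W := by
  refine ⟨homogeneousComponent_mem_invariants b W d hf.1, ?_⟩
  rw [constantCoeff_eq, coeff_homogeneousComponent, ← constantCoeff_eq, hf.2, ite_self]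

variable [Fintype W]

/-- The Reynolds operator: averaging over the group. -/
noncomputable def reynolds : MvPolynomial (Fin n) ℂ →ₗ[ℂ] MvPolynomial (Fin n) ℂ :=
  (Fintype.card W : ℂ)⁻¹ • ∑ w : W, (act b (w : V ≃ₗᵢ[ℂ] V)).toLinearMap

theorem reynolds_apply (f : MvPolynomial (Fin n) ℂ) :
    reynolds b W f = (Fintype.card W : ℂ)⁻¹ • ∑ w : W, act b (w : V ≃ₗᵢ[ℂ] V) f := by
  simp [reynolds, LinearMap.sum_apply]

theorem card_ne_zero : (Fintype.card W : ℂ) ≠ 0 := Nat.cast_ne_zero.2 Fintype.card_ne_zero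

theorem reynolds_mem (f : MvPolynomial (Fin n) ℂ) : reynolds b W f ∈ invariants b W := by
  refine (mem_invariants b W).2 fun w hw => ?_
  have h : ∀ x : W, act b w (act b (x : V ≃ₗᵢ[ℂ] V) f) =
      act b ((⟨w, hw⟩ * x : W) : V ≃ₗᵢ[ℂ] V) f := fun x => by
    rw [Subgroup.coe_mul, act_mul]
  have h2 : ∑ x : W, act b ((⟨w, hw⟩ * x : W) : V ≃ₗᵢ[ℂ] V) f =
      ∑ x : W, act b (x : V ≃ₗᵢ[ℂ] V) f :=
    Fintype.sum_equiv (Equiv.mulLeft (⟨w, hw⟩ : W)) _ _ fun x => by rw [Equiv.coe_mulLeft]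
  rw [reynolds_apply, map_smul, map_sum, Finset.sum_congr rfl fun x _ => h x, h2]

theorem reynolds_mul {r : MvPolynomial (Fin n) ℂ} (hr : r ∈ invariants b W)
    (f : MvPolynomial (Fin n) ℂ) : reynolds b W (r * f) = r * reynolds b W f := by
  rw [reynolds_apply, reynolds_apply, mul_smul_comm, Finset.mul_sum]
  congr 1
  exact Finset.sum_congr rfl fun w _ => by rw [map_mul, hr w w.2]

theorem constantCoeff_reynolds (f : MvPolynomial (Fin n) ℂ) :
    constantCoeff (reynolds b W f) = constantCoeff f := by
  rw [reynolds_apply, smul_eq_C_mul, map_mul, map_sum]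
  simp only [constantCoeff_act, constantCoeff_C, Finset.sum_const, Finset.card_univ, nsmul_eq_mul]
  rw [← mul_assoc, inv_mul_cancel₀ (card_ne_zero W), one_mul]

theorem reynolds_sub_mem {N : Submodule ℂ (MvPolynomial (Fin n) ℂ)} {f : MvPolynomial (Fin n) ℂ}
    (h : ∀ w ∈ W, act b w f - f ∈ N) : reynolds b W f - f ∈ N := by
  have e : reynolds b W f - f =
      (Fintype.card W : ℂ)⁻¹ • ∑ w : W, (act b (w : V ≃ₗᵢ[ℂ] V) f - f) := by
    rw [Finset.sum_sub_distrib, smul_sub, ← reynolds_apply, Finset.sum_const, Finset.card_univ,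
      ← Nat.cast_smul_eq_nsmul ℂ, smul_smul, inv_mul_cancel₀ (card_ne_zero W), one_smul]
  rw [e]
  exact N.smul_mem _ (N.sum_mem fun w _ => h w w.2)

theorem reynolds_eq_self {f : MvPolynomial (Fin n) ℂ} (hf : f ∈ invariants b W) :
    reynolds b W f = f := by
  have h := reynolds_sub_mem b W (N := ⊥) (f := f) fun w hw => by simp [hf w hw]
  exact sub_eq_zero.1 ((Submodule.mem_bot ℂ).1 h)

/-- Against an invariant, the apolar product sees only the average over the group. -/
theorem apolar_reynolds {g : MvPolynomial (Fin n) ℂ} (hg : g ∈ invariants b W)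
    (f : MvPolynomial (Fin n) ℂ) : apolar (reynolds b W f) g = apolar f g := by
  have h : ∀ w : W, apolar (act b (w : V ≃ₗᵢ[ℂ] V) f) g = apolar f g := fun w => by
    conv_lhs => rw [← hg w w.2]
    exact apolar_act b _ f g
  rw [reynolds_apply, apolar_smul_left, ← apolarForm_apply, map_sum, LinearMap.sum_apply]
  simp only [apolarForm_apply, h, Finset.sum_const, Finset.card_univ, nsmul_eq_mul, map_inv₀,
    map_natCast]
  rw [← mul_assoc, inv_mul_cancel₀ (card_ne_zero W), one_mul]

end Action

/-! ### Relations over the ring of invariants of a reflection group -/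

section Reflection

variable {V : Type*} [NormedAddCommGroup V] [InnerProductSpace ℂ V] {n : ℕ}
  (b : OrthonormalBasis (Fin n) ℂ V)

/-- A linear form `ℓ` cutting out the hyperplane of a reflection `s` divides `s • f - f` for every
polynomial `f`. -/
theorem exists_linear_form_dvd {s : V ≃ₗᵢ[ℂ] V} (hs : IsReflection s) :
    ∃ l : MvPolynomial (Fin n) ℂ, l.IsHomogeneous 1 ∧ l ≠ 0 ∧ ∀ f, l ∣ act b s f - f := by
  have : FiniteDimensional ℂ V := Module.Finite.of_basis b.toBasis
  set T : V →ₗ[ℂ] V := s.toLinearEquiv.toLinearMap - LinearMap.id with hT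
  have hrank : Module.finrank ℂ (LinearMap.range T) = 1 := by
    have h1 := T.finrank_range_add_finrank_ker
    have h2 : Module.finrank ℂ (LinearMap.ker T) + 1 = Module.finrank ℂ V := hs
    omega
  obtain ⟨⟨v₀, hv₀⟩, hne, hgen⟩ := finrank_eq_one_iff'.1 hrank
  have hc : ∀ k, ∃ c : ℂ, c • v₀ = T (b k) := fun k => by
    obtain ⟨c, hc⟩ := hgen ⟨T (b k), LinearMap.mem_range_self T _⟩
    exact ⟨c, congrArg Subtype.val hc⟩
  choose c hc using hc
  have hinv : ∀ k, s⁻¹ (b k) = b k + c k • -(s⁻¹ v₀) := fun k => by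
    have h : T (b k) = s (b k) - b k := rfl
    have h2 : s⁻¹ (s (b k)) = b k := s.symm_apply_apply _
    rw [smul_neg, ← map_smul, hc, h, map_sub, h2]
    abel
  have hX : ∀ j, act b s (X j) - X j = (∑ k, C (c k) * X k) * C (b.repr (-(s⁻¹ v₀)) j) := by
    intro j
    have h1 := act_X b 1 j
    rw [act_one] at h1
    rw [act_X]
    conv_lhs => rw [h1]
    rw [← Finset.sum_sub_distrib, Finset.sum_mul]
    refine Finset.sum_congr rfl fun k _ => ?_
    rw [hinv, inv_one, LinearIsometryEquiv.coe_one, id_eq, map_add, map_smul, PiLp.add_apply,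
      PiLp.smul_apply, smul_eq_mul, C_add, C_mul]
    ring
  refine ⟨∑ k, C (c k) * X k, IsHomogeneous.sum _ _ _ fun k _ => isHomogeneous_C_mul_X _ _, ?_, ?_⟩
  · intro h0
    have hc0 : ∀ k, c k = 0 := fun k => by
      have h := congrArg (coeff (Finsupp.single k 1)) h0
      classical
      simpa [coeff_sum, coeff_C_mul, coeff_X, Finsupp.single_left_inj] using h
    have hT0 : T = 0 := b.toBasis.ext fun k => by
      rw [OrthonormalBasis.coe_toBasis, ← hc, hc0, zero_smul, LinearMap.zero_apply]
    obtain ⟨x, hx⟩ := hv₀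
    rw [hT0, LinearMap.zero_apply] at hx
    exact hne (Subtype.ext hx.symm)
  · intro f
    induction f using MvPolynomial.induction_on with
    | C a => simp
    | add p q hp hq =>
      rw [map_add, add_sub_add_comm]
      exact dvd_add hp hq
    | mul_X p j hp =>
      have e : act b s (p * X j) - p * X j =
          (act b s p - p) * act b s (X j) + p * (act b s (X j) - X j) := by rw [map_mul]; ring
      rw [e, hX]
      exact dvd_add (hp.mul_right _) ((dvd_mul_right _ _).mul_left _)

variable (W : Subgroup (V ≃ₗᵢ[ℂ] V))

/-- The ideal of the polynomial algebra generated by the invariants without constant term. -/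
noncomputable def coinvariantIdeal : Ideal (MvPolynomial (Fin n) ℂ) :=
  Ideal.span (positiveInvariants b W : Set (MvPolynomial (Fin n) ℂ))

theorem act_mem_coinvariantIdeal {w : V ≃ₗᵢ[ℂ] V} (hw : w ∈ W) {f : MvPolynomial (Fin n) ℂ}
    (hf : f ∈ coinvariantIdeal b W) : act b w f ∈ coinvariantIdeal b W := by
  have h : coinvariantIdeal b W ≤ (coinvariantIdeal b W).comap (act b w) :=
    Ideal.span_le.2 fun r hr => by
      rw [SetLike.mem_coe, Ideal.mem_comap, hr.1 w hw]
      exact Ideal.subset_span hr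
  exact h hf

/-- A polynomial fixed by all reflections modulo the coinvariant ideal is fixed by the group. -/
theorem act_sub_mem_coinvariantIdeal (hW : IsReflectionGroup W) {f : MvPolynomial (Fin n) ℂ}
    (hf : ∀ s ∈ W, IsReflection s → act b s f - f ∈ coinvariantIdeal b W) :
    ∀ w ∈ W, act b w f - f ∈ coinvariantIdeal b W := by
  have hle : ∀ w ∈ Subgroup.closure {s : V ≃ₗᵢ[ℂ] V | s ∈ W ∧ IsReflection s}, w ∈ W :=
    fun w hw => by rwa [hW] at hw
  intro w hw
  rw [← hW] at hw
  induction hw using Subgroup.closure_induction with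
  | mem s hs => exact hf s hs.1 hs.2
  | one => rw [act_one, sub_self]; exact zero_mem _
  | mul x y hx hy ihx ihy =>
    have e : act b (x * y) f - f = act b x (act b y f - f) + (act b x f - f) := by
      rw [act_mul, map_sub]; ring
    rw [e]
    exact add_mem (act_mem_coinvariantIdeal b W (hle x hx) ihy) ihx
  | inv x hx ih =>
    have e : act b x⁻¹ f - f = -act b x⁻¹ (act b x f - f) := by
      rw [map_sub, ← act_mul, inv_mul_cancel, act_one]; ring
    rw [e]
    exact neg_mem (act_mem_coinvariantIdeal b W (inv_mem (hle x hx)) ih)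

variable [Fintype W]

/-- Chevalley's lemma on relations. Let `∑ H_i p_i = 0` with invariant `H_i`, and let `φ` be a
linear functional on the invariants that on the ideal of the `H_i` is linear over the invariants,
these acting on `ℂ` through their constant terms. Then `∑ φ(H_i) p_i` lies in the coinvariant
ideal. The divided differences `(s • p_i - p_i) / ℓ_s` satisfy the same relation in lower degree,
so `∑ φ(H_i) p_i` is invariant modulo the ideal and can be replaced by its average; and averaging
the relation and applying `φ` shows that this average has no constant term. -/
theorem sum_smul_mem_coinvariantIdeal (hW : IsReflectionGroup W) {ι : Type*} [Fintype ι]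
    (H : ι → invariants b W) (φ : invariants b W →ₗ[ℂ] ℂ)
    (hφ : ∀ r i, φ (r * H i) = constantCoeff (r : MvPolynomial (Fin n) ℂ) * φ (H i))
    (p : ι → MvPolynomial (Fin n) ℂ)
    (hp : ∑ i, (H i : MvPolynomial (Fin n) ℂ) * p i = 0) :
    ∑ i, φ (H i) • p i ∈ coinvariantIdeal b W := by
  -- A degree bound that, unlike `totalDegree`, separates zero from the nonzero constants.
  suffices key : ∀ (N : ℕ) (p : ι → MvPolynomial (Fin n) ℂ),
      (∀ i, p i = 0 ∨ (p i).totalDegree < N) →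
      ∑ i, (H i : MvPolynomial (Fin n) ℂ) * p i = 0 →
      ∑ i, φ (H i) • p i ∈ coinvariantIdeal b W by
    refine key (∑ i, (p i).totalDegree + 1) p (fun i => Or.inr ?_) hp
    exact Nat.lt_succ_of_le
      (Finset.single_le_sum (f := fun i => (p i).totalDegree) (fun _ _ => Nat.zero_le _)
        (Finset.mem_univ i))
  clear hp p
  intro N
  induction N with
  | zero =>
    intro p hdeg _
    have h0 : ∀ i, p i = 0 := fun i => (hdeg i).resolve_right (Nat.not_lt_zero _)
    simp [h0]
  | succ N ih =>
    intro p hdeg hp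
    set q := ∑ i, φ (H i) • p i with hq
    have hrefl : ∀ s ∈ W, IsReflection s → act b s q - q ∈ coinvariantIdeal b W := by
      intro s hsW hs
      obtain ⟨l, hl1, hl0, hl⟩ := exists_linear_form_dvd b hs
      choose Δ hΔ using fun i => hl (p i)
      have hrel : ∑ i, (H i : MvPolynomial (Fin n) ℂ) * Δ i = 0 := by
        refine mul_left_cancel₀ hl0 ?_
        have h1 : ∀ i, l * ((H i : MvPolynomial (Fin n) ℂ) * Δ i) =
            act b s (H i * p i) - H i * p i := fun i => by
          rw [map_mul, (H i).2 s hsW, ← mul_sub, hΔ]; ring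
        rw [Finset.mul_sum, Finset.sum_congr rfl fun i _ => h1 i, Finset.sum_sub_distrib,
          ← map_sum, hp, map_zero, sub_zero, mul_zero]
      have hdegΔ : ∀ i, Δ i = 0 ∨ (Δ i).totalDegree < N := by
        intro i
        by_cases hz : Δ i = 0
        · exact Or.inl hz
        right
        have hpi : p i ≠ 0 := fun h => by
          have h1 := hΔ i
          rw [h, map_zero, sub_zero] at h1
          exact (mul_ne_zero hl0 hz) h1.symm
        have h1 := (hdeg i).resolve_left hpi
        have h2 := totalDegree_mul_of_isDomain hl0 hz
        rw [← hΔ, hl1.totalDegree hl0] at h2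
        have h3 := totalDegree_sub (act b s (p i)) (p i)
        have h4 := totalDegree_act_le b s (p i)
        rw [max_eq_right h4] at h3
        omega
      have e : act b s q - q = l * ∑ i, φ (H i) • Δ i := by
        rw [hq, map_sum, ← Finset.sum_sub_distrib, Finset.mul_sum]
        refine Finset.sum_congr rfl fun i _ => ?_
        rw [map_smul, ← smul_sub, hΔ, mul_smul_comm]
      rw [e]
      exact Ideal.mul_mem_left _ _ (ih Δ hdegΔ hrel)
    have hmem : reynolds b W q - q ∈ coinvariantIdeal b W :=
      reynolds_sub_mem b W (N := (coinvariantIdeal b W).restrictScalars ℂ)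
        (act_sub_mem_coinvariantIdeal b W hW hrefl)
    have hconst : constantCoeff (reynolds b W q) = 0 := by
      have h1 : ∑ i, (⟨reynolds b W (p i), reynolds_mem b W _⟩ : invariants b W) * H i = 0 := by
        refine Subtype.ext ?_
        have h2 := congrArg (reynolds b W) hp
        rw [map_sum, map_zero, Finset.sum_congr rfl fun i _ => reynolds_mul b W (H i).2 (p i)] at h2
        rw [AddSubmonoidClass.coe_finsetSum]
        refine Eq.trans ?_ h2
        exact Finset.sum_congr rfl fun i _ => mul_comm _ _
      have h3 := congrArg φ h1
      rw [map_sum, map_zero, Finset.sum_congr rfl fun i _ => hφ _ i] at h3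
      rw [hq, map_sum, map_sum, ← h3]
      refine Finset.sum_congr rfl fun i _ => ?_
      rw [map_smul, smul_eq_C_mul, map_mul, constantCoeff_C, mul_comm]
    have h5 : reynolds b W q ∈ coinvariantIdeal b W :=
      Ideal.subset_span ⟨reynolds_mem b W q, hconst⟩
    have h6 := sub_mem h5 hmem
    rwa [sub_sub_cancel] at h6

/-- The average of a product of a polynomial without constant term and an element of the
coinvariant ideal is decomposable. -/
theorem reynolds_mul_mem {x y : MvPolynomial (Fin n) ℂ} (hx : constantCoeff x = 0)
    (hy : y ∈ coinvariantIdeal b W) :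
    reynolds b W (x * y) ∈ positiveInvariants b W * positiveInvariants b W := by
  induction hy using Submodule.span_induction generalizing x with
  | mem r hr =>
    rw [mul_comm x, reynolds_mul b W hr.1]
    exact Submodule.mul_mem_mul hr ⟨reynolds_mem b W x, by rw [constantCoeff_reynolds, hx]⟩
  | zero => rw [mul_zero, map_zero]; exact zero_mem _
  | add y z _ _ hy hz => rw [mul_add, map_add]; exact add_mem (hy hx) (hz hx)
  | smul a y _ hy =>
    rw [smul_eq_mul, ← mul_assoc]
    exact hy (by rw [map_mul, hx, zero_mul])

end Reflection

/-! ### Algebraic independence -/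

/-- By Nakayama's lemma, a nonzero finitely generated ideal `J` of a domain has a nonzero
quotient by `𝔪 J`, where `𝔪` is the kernel of an augmentation `ε`; a functional on this quotient
is given here on the whole algebra. -/
theorem exists_functional {A : Type*} [CommRing A] [IsDomain A] [Algebra ℂ A] (ε : A →ₐ[ℂ] ℂ)
    {ι : Type*} [Finite ι] (H : ι → A) (hH : H ≠ 0) :
    ∃ φ : A →ₗ[ℂ] ℂ, (∀ r i, φ (r * H i) = ε r * φ (H i)) ∧ ∃ i, φ (H i) ≠ 0 := by
  set J : Ideal A := Ideal.span (Set.range H) with hJ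
  set m : Ideal A := RingHom.ker ε with hm
  have hlt : ¬ J ≤ m • J := by
    intro hle
    obtain ⟨r, hr1, hr⟩ := Submodule.exists_sub_one_mem_and_smul_eq_zero_of_fg_of_le_smul m J
      (Submodule.fg_span (Set.finite_range H)) hle
    obtain ⟨i, hi⟩ := Function.ne_iff.1 hH
    have h1 : r * H i = 0 := hr _ (Ideal.subset_span ⟨i, rfl⟩)
    rw [(mul_eq_zero.1 h1).resolve_right hi, hm, RingHom.mem_ker, zero_sub, map_neg, map_one] at hr1
    exact one_ne_zero (neg_eq_zero.1 hr1)
  have hlt' : ∃ i, H i ∉ m • J := by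
    by_contra! h
    exact hlt (Ideal.span_le.2 (by rintro _ ⟨i, rfl⟩; exact h i))
  obtain ⟨i, hi⟩ := hlt'
  obtain ⟨φ, hφi, hφ⟩ := Submodule.exists_le_ker_of_notMem
    (p := (m • J : Submodule A A).restrictScalars ℂ) (v := H i) hi
  refine ⟨φ, fun r j => ?_, i, hφi⟩
  have h1 : (r - algebraMap ℂ A (ε r)) * H j ∈ m • J :=
    Submodule.smul_mem_smul (by rw [hm, RingHom.mem_ker, map_sub, AlgHom.commutes]; simp)
      (Ideal.subset_span ⟨j, rfl⟩)
  have h2 : φ ((r - algebraMap ℂ A (ε r)) * H j) = 0 := hφ h1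
  rw [sub_mul, map_sub, ← Algebra.smul_def, map_smul, smul_eq_mul] at h2
  exact sub_eq_zero.1 h2

theorem pderiv_aeval {σ ι : Type*} [Fintype ι] (k : σ) (f : ι → MvPolynomial σ ℂ)
    (H : MvPolynomial ι ℂ) :
    pderiv k (aeval f H) = ∑ i, aeval f (pderiv i H) * pderiv k (f i) := by
  classical
  induction H using MvPolynomial.induction_on with
  | C a => simp [algebraMap_eq]
  | add p q hp hq => simp only [map_add, add_mul, Finset.sum_add_distrib, hp, hq]
  | mul_X p j hp =>
    rw [map_mul, pderiv_mul, hp, aeval_X]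
    simp only [pderiv_mul, pderiv_X, map_add, map_mul, aeval_X, add_mul, Finset.sum_add_distrib,
      Finset.sum_mul]
    have h : ∑ i, aeval f p * aeval f ((Pi.single i 1 : ι → MvPolynomial ι ℂ) j) * pderiv k (f i) =
        aeval f p * pderiv k (f j) := by
      rw [Finset.sum_eq_single j (fun i _ hi => by simp [Pi.single_eq_of_ne hi.symm]) (by simp),
        Pi.single_eq_same, map_one, mul_one]
    rw [h]
    exact congrArg₂ _ (Finset.sum_congr rfl fun i _ => by ring) rfl

theorem totalDegree_pderiv_lt {ι : Type*} (i : ι) (H : MvPolynomial ι ℂ) (h : pderiv i H ≠ 0) :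
    (pderiv i H).totalDegree < H.totalDegree := by
  have hle : ∀ m ∈ (pderiv i H).support, m.degree + 1 ≤ H.totalDegree := by
    intro m hm
    have h1 : m + Finsupp.single i 1 ∈ H.support := by
      rw [mem_support_iff, coeff_pderiv] at hm
      exact mem_support_iff.2 (left_ne_zero_of_mul hm)
    have h2 := le_totalDegree h1
    change (m + Finsupp.single i 1).degree ≤ _ at h2
    simpa using h2
  obtain ⟨m, hm⟩ := Finset.nonempty_iff_ne_empty.2 (mt support_eq_empty.1 h)
  have h1 := hle m hm
  have h2 : (pderiv i H).totalDegree ≤ H.totalDegree - 1 :=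
    Finset.sup_le fun m hm => Nat.le_sub_one_of_lt (hle m hm)
  omega

theorem eq_C_of_forall_pderiv_eq_zero {ι : Type*} {H : MvPolynomial ι ℂ}
    (h : ∀ i, pderiv i H = 0) : H = C (coeff 0 H) := by
  classical
  ext a
  rw [coeff_C]
  split_ifs with ha
  · rw [← ha]
  · obtain ⟨i, hi⟩ := Finsupp.ne_iff.1 (Ne.symm ha)
    have h1 : a - Finsupp.single i 1 + Finsupp.single i 1 = a :=
      tsub_add_cancel_of_le (Finsupp.single_le_iff.2 (Nat.one_le_iff_ne_zero.2 hi))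
    have h2 := congrArg (coeff (a - Finsupp.single i 1)) (h i)
    rw [coeff_pderiv, h1, coeff_zero] at h2
    exact (mul_eq_zero.1 h2).resolve_right (Nat.cast_add_one_ne_zero _)

/-- If the relations between the `f i` are closed under partial derivatives, there are none: a
nonzero relation could be differentiated down to a nonzero constant. -/
theorem algebraicIndependent_of_aeval_pderiv {ι A : Type*} [CommRing A] [Nontrivial A]
    [Algebra ℂ A] (f : ι → A)
    (hf : ∀ H : MvPolynomial ι ℂ, aeval f H = 0 → ∀ i, aeval f (pderiv i H) = 0) :
    AlgebraicIndependent ℂ f := by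
  rw [algebraicIndependent_iff]
  intro H
  induction hN : H.totalDegree using Nat.strong_induction_on generalizing H with
  | _ N ih =>
    intro hH
    have h0 : ∀ i, pderiv i H = 0 := fun i => by
      by_contra hne
      exact hne (ih _ (hN ▸ totalDegree_pderiv_lt i H hne) _ rfl (hf H hH i))
    have hC := eq_C_of_forall_pderiv_eq_zero h0
    rw [hC, aeval_C] at hH
    rw [hC, (map_eq_zero (algebraMap ℂ A)).1 hH, C_0]

section Chevalley

variable {V : Type*} [NormedAddCommGroup V] [InnerProductSpace ℂ V] {n : ℕ}
  (b : OrthonormalBasis (Fin n) ℂ V) (W : Subgroup (V ≃ₗᵢ[ℂ] V))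

/-- Homogeneous invariants of positive degree of a reflection group that are linearly independent
modulo decomposable invariants are algebraically independent. For a relation `H(f) = 0`, the
derivatives `∂_k` give the relations `∑ i, (∂_i H)(f) * ∂_k f_i = 0`; Chevalley's lemma turns these
into `∑ i, c_i ∂_k f_i` in the coinvariant ideal, and Euler's identity and averaging give a
linear relation between the `f_i` modulo decomposables. -/
theorem algebraicIndependent_of_linearIndependent_mod [Finite W] (hW : IsReflectionGroup W)
    {ι : Type*} [Fintype ι] (f : ι → MvPolynomial (Fin n) ℂ)
    (hhom : ∀ i, ∃ d, (f i).IsHomogeneous d) (hf : ∀ i, f i ∈ positiveInvariants b W)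
    (hind : ∀ c : ι → ℂ, ∑ i, c i • f i ∈
      positiveInvariants b W * positiveInvariants b W → ∀ i, c i = 0) :
    AlgebraicIndependent ℂ f := by
  classical
  cases nonempty_fintype W
  choose d hd using hhom
  have hd0 : ∀ i, d i ≠ 0 := fun i hi => by
    have h1 := hd i
    rw [hi, ← totalDegree_zero_iff_isHomogeneous, totalDegree_eq_zero_iff_eq_C,
      ← constantCoeff_eq, (hf i).2, C_0] at h1
    have h2 := hind (Pi.single i 1) (by simp [Pi.single_apply, h1]) i
    simp at h2
  refine algebraicIndependent_of_aeval_pderiv f fun H hH => ?_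
  let F : ι → invariants b W := fun i => ⟨f i, (hf i).1⟩
  have hF : ∀ P : MvPolynomial ι ℂ, ((aeval F P : invariants b W) : MvPolynomial (Fin n) ℂ) =
      aeval f P := fun P => comp_aeval_apply F (invariants b W).val P
  by_contra! hne
  obtain ⟨i₀, hi₀⟩ := hne
  obtain ⟨φ, hφ, i₁, hi₁⟩ := exists_functional
    ((aeval (0 : Fin n → ℂ)).comp (invariants b W).val) (fun i => aeval F (pderiv i H)) fun h0 =>
      hi₀ (by rw [← hF, congrFun h0 i₀]; rfl)
  set c : ι → ℂ := fun i => φ (aeval F (pderiv i H)) with hc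
  have hmem : ∀ k, ∑ i, c i • pderiv k (f i) ∈ coinvariantIdeal b W := fun k => by
    refine sum_smul_mem_coinvariantIdeal b W hW (fun i => aeval F (pderiv i H)) φ
      (fun r i => ?_) _ ?_
    · rw [hφ]
      congr 1
      simp [constantCoeff]
    · simp only [hF]
      rw [← pderiv_aeval, hH, map_zero]
  have heuler : ∑ k, X k * ∑ i, c i • pderiv k (f i) = ∑ i, (c i * d i) • f i := by
    simp only [Finset.mul_sum, mul_smul_comm]
    rw [Finset.sum_comm]
    refine Finset.sum_congr rfl fun i _ => ?_
    rw [← Finset.smul_sum, (hd i).sum_X_mul_pderiv, mul_smul, Nat.cast_smul_eq_nsmul]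
  have hdec : ∑ i, (c i * d i) • f i ∈ positiveInvariants b W * positiveInvariants b W := by
    have hinv : ∑ i, (c i * d i) • f i ∈ invariants b W :=
      sum_mem fun i _ => Subalgebra.smul_mem _ (hf i).1 _
    rw [← reynolds_eq_self b W hinv, ← heuler, map_sum]
    exact sum_mem fun k _ => reynolds_mul_mem b W (constantCoeff_X _ k) (hmem k)
  have h := hind _ hdec i₁
  exact hi₁ ((mul_eq_zero.1 h).resolve_right (Nat.cast_ne_zero.2 (hd0 i₁)))

end Chevalley

/-! ### Construction of the canonical system -/

section Canonical

variable {V : Type*} [NormedAddCommGroup V] [InnerProductSpace ℂ V] {n : ℕ}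
  (b : OrthonormalBasis (Fin n) ℂ V) (W : Subgroup (V ≃ₗᵢ[ℂ] V))

/-- The polynomial algebra is integral over the invariants of a finite group. -/
theorem isIntegral_invariants [Finite W] :
    Algebra.IsIntegral (invariants b W) (MvPolynomial (Fin n) ℂ) := by
  let _ : MulSemiringAction W (MvPolynomial (Fin n) ℂ) :=
    { smul := fun w f => act b (w : V ≃ₗᵢ[ℂ] V) f
      one_smul := act_one b
      mul_smul := fun w₁ w₂ => act_mul b w₁ w₂
      smul_zero := fun w => map_zero _
      smul_add := fun w => map_add _
      smul_one := fun w => map_one _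
      smul_mul := fun w => map_mul _ }
  have : Algebra.IsInvariant (invariants b W) (MvPolynomial (Fin n) ℂ) W :=
    ⟨fun f hf => ⟨⟨f, fun w hw => hf ⟨w, hw⟩⟩, rfl⟩⟩
  exact Algebra.IsInvariant.isIntegral (invariants b W) (MvPolynomial (Fin n) ℂ) W

/-- In each degree `d`, an orthonormal basis of the orthogonal complement of the decomposable
invariants in the space of invariants of positive degree. -/
theorem exists_orthonormal_indecomposables (d : ℕ) :
    ∃ (m : ℕ) (e : Fin m → MvPolynomial (Fin n) ℂ),
      (∀ i j, apolar (e i) (e j) = if i = j then 1 else 0) ∧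
      (∀ i, e i ∈ positiveInvariants b W) ∧ (∀ i, (e i).IsHomogeneous d) ∧
      (∀ i, ∀ q ∈ positiveInvariants b W * positiveInvariants b W, apolar (e i) q = 0) ∧
      ∀ g ∈ positiveInvariants b W, g.IsHomogeneous d →
        ∃ q ∈ positiveInvariants b W * positiveInvariants b W,
          g - homogeneousComponent d q ∈ Submodule.span ℂ (Set.range e) := by
  let _ : NormedAddCommGroup (MvPolynomial (Fin n) ℂ) :=
    InnerProductSpace.Core.toNormedAddCommGroup (cd := apolarCore n)
  let _ : InnerProductSpace ℂ (MvPolynomial (Fin n) ℂ) :=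
    InnerProductSpace.ofCore (apolarCore n).toCore
  have hfin : Module.Finite ℂ (homogeneousSubmodule (Fin n) ℂ d) :=
    Module.Finite.iff_fg.2 (homogeneousSubmodule_fg (Fin n) ℂ d)
  have : FiniteDimensional ℂ (positiveInvariants b W ⊓ homogeneousSubmodule (Fin n) ℂ d :
      Submodule ℂ (MvPolynomial (Fin n) ℂ)) := Submodule.finiteDimensional_of_le inf_le_right
  have hmul : positiveInvariants b W * positiveInvariants b W ≤ positiveInvariants b W :=
    Submodule.mul_le.2 fun f hf g hg =>
      ⟨mul_mem hf.1 hg.1, by rw [map_mul, hf.2, zero_mul]⟩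
  obtain ⟨m, e, he, hM, hQ, hspan⟩ := exists_orthonormal_complement
    (positiveInvariants b W ⊓ homogeneousSubmodule (Fin n) ℂ d)
    ((positiveInvariants b W * positiveInvariants b W).map (homogeneousComponent d)) (by
      rintro _ ⟨q, hq, rfl⟩
      exact ⟨homogeneousComponent_mem_positiveInvariants b W d (hmul hq),
        homogeneousComponent_mem d q⟩)
  refine ⟨m, e, fun i j => orthonormal_iff_ite.1 he i j, fun i => (hM i).1, fun i => (hM i).2,
    fun i q hq => ?_, fun g hg hgd => ?_⟩
  · rw [← apolar_homogeneousComponent (hM i).2]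
    exact hQ i _ ⟨q, hq, rfl⟩
  · obtain ⟨_, ⟨q, hq, rfl⟩, z, hz, hqz⟩ := Submodule.mem_sup.1 (hspan ⟨hg, hgd⟩)
    refine ⟨q, hq, ?_⟩
    rwa [← hqz, add_sub_cancel_left]

/-- The homogeneous components of a product of polynomials without constant term only involve
components of the factors of strictly smaller degree. -/
theorem homogeneousComponent_mul_mem {A : Subalgebra ℂ (MvPolynomial (Fin n) ℂ)} {d : ℕ}
    {f g : MvPolynomial (Fin n) ℂ} (hf0 : constantCoeff f = 0) (hg0 : constantCoeff g = 0)
    (hf : ∀ k < d, homogeneousComponent k f ∈ A) (hg : ∀ k < d, homogeneousComponent k g ∈ A) :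
    homogeneousComponent d (f * g) ∈ A := by
  have hzero : ∀ {h : MvPolynomial (Fin n) ℂ}, constantCoeff h = 0 →
      homogeneousComponent 0 h = 0 := fun hh => by
    rw [homogeneousComponent_zero, ← constantCoeff_eq, hh, C_0]
  rw [← sum_homogeneousComponent f, ← sum_homogeneousComponent g, Finset.sum_mul_sum, map_sum]
  refine sum_mem fun i _ => ?_
  rw [map_sum]
  refine sum_mem fun j _ => ?_
  rw [homogeneousComponent_of_mem ((homogeneousComponent_isHomogeneous i f).mul
    (homogeneousComponent_isHomogeneous j g))]
  split_ifs with hd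
  · rcases Nat.eq_zero_or_pos i with rfl | hi
    · rw [hzero hf0, zero_mul]; exact zero_mem A
    rcases Nat.eq_zero_or_pos j with rfl | hj
    · rw [hzero hg0, mul_zero]; exact zero_mem A
    exact mul_mem (hf i (by omega)) (hg j (by omega))
  · exact zero_mem A

/-- Homogeneous invariants that span the invariants of positive degree modulo the decomposable
ones generate the algebra of invariants. -/
theorem adjoin_eq_invariants {ι : Type*} (f : ι → MvPolynomial (Fin n) ℂ)
    (hf : ∀ i, f i ∈ invariants b W)
    (hspan : ∀ d, ∀ g ∈ positiveInvariants b W, g.IsHomogeneous d →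
      ∃ q ∈ positiveInvariants b W * positiveInvariants b W,
        g - homogeneousComponent d q ∈ Submodule.span ℂ (Set.range f)) :
    Algebra.adjoin ℂ (Set.range f) = invariants b W := by
  refine le_antisymm (Algebra.adjoin_le (by rintro _ ⟨i, rfl⟩; exact hf i)) ?_
  have key : ∀ d, ∀ g ∈ invariants b W,
      homogeneousComponent d g ∈ Algebra.adjoin ℂ (Set.range f) := by
    intro d
    induction d using Nat.strong_induction_on with
    | _ d ih =>
      intro g hg
      rcases Nat.eq_zero_or_pos d with rfl | hd
      · rw [homogeneousComponent_zero]
        exact Subalgebra.algebraMap_mem _ _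
      have hpos : homogeneousComponent d g ∈ positiveInvariants b W := by
        refine ⟨homogeneousComponent_mem_invariants b W d hg, ?_⟩
        rw [constantCoeff_eq, coeff_homogeneousComponent, if_neg (by simpa using hd.ne)]
      obtain ⟨q, hq, hgq⟩ := hspan d _ hpos (homogeneousComponent_isHomogeneous d g)
      have h1 : positiveInvariants b W * positiveInvariants b W ≤
          (Algebra.adjoin ℂ (Set.range f)).toSubmodule.comap (homogeneousComponent d) :=
        Submodule.mul_le.2 fun x hx y hy =>
          homogeneousComponent_mul_mem hx.2 hy.2 (fun k hk => ih k hk x hx.1)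
            fun k hk => ih k hk y hy.1
      have h2 := Algebra.span_le_adjoin ℂ (Set.range f) hgq
      have h3 := add_mem h2 (h1 hq)
      rwa [sub_add_cancel] at h3
  intro g hg
  rw [← sum_homogeneousComponent g]
  exact sum_mem fun d _ => key d g hg

theorem constantCoeff_starOp (f g : MvPolynomial (Fin n) ℂ) :
    constantCoeff (starOp f g) = apolar f g := by
  have h := apolar_mul_left f 1 g
  rw [mul_one] at h
  rw [h, ← C_1, apolar_C_left, map_one, one_mul]

/-- If `g` is orthogonal to the decomposable invariants then `f^* g` is constant: for `p` without
constant term, `⟪p, f^* g⟫ = ⟪f p, g⟫`, and here `p` may be replaced by its average. -/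
theorem starOp_eq_C_of_orthogonal [Finite W] {f g : MvPolynomial (Fin n) ℂ}
    (hf : f ∈ positiveInvariants b W) (hg : g ∈ invariants b W)
    (hq : ∀ q ∈ positiveInvariants b W * positiveInvariants b W, apolar g q = 0) :
    starOp f g = C (apolar f g) := by
  cases nonempty_fintype W
  have horth : ∀ p, constantCoeff p = 0 → apolar p (starOp f g) = 0 := fun p hp => by
    rw [← apolar_mul_left, ← apolar_reynolds b W hg, reynolds_mul b W hf.1, ← conj_apolar,
      hq _ (Submodule.mul_mem_mul hf
        ⟨reynolds_mem b W p, by rw [constantCoeff_reynolds, hp]⟩), map_zero]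
  set p := starOp f g - C (apolar f g) with hp
  have hp0 : constantCoeff p = 0 := by
    rw [hp, map_sub, constantCoeff_starOp, constantCoeff_C, sub_self]
  have hdecomp : starOp f g = p + C (apolar f g) := (sub_add_cancel _ _).symm
  have h1 := horth p hp0
  rw [hdecomp, apolar_add_right, ← conj_apolar p (C _), apolar_C_left, hp0, mul_zero, map_zero,
    add_zero] at h1
  rw [hdecomp, eq_zero_of_apolar_self_eq_zero p h1, zero_add]

/-- Chevalley's theorem, together with the choice of generators that makes them canonical. -/
theorem exists_isCanonicalSystem [Finite W] (hW : IsReflectionGroup W) :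
    ∃ f : Fin n → MvPolynomial (Fin n) ℂ, IsCanonicalSystem b W f := by
  choose m e horth hpos hhom hdec hspan using exists_orthonormal_indecomposables b W
  let f : (Σ d, Fin (m d)) → MvPolynomial (Fin n) ℂ := fun x => e x.1 x.2
  have hforth : ∀ x y, apolar (f x) (f y) = if x = y then 1 else 0 := by
    rintro ⟨d, i⟩ ⟨d', j⟩
    by_cases hd : d = d'
    · subst hd
      simp only [f, horth, Sigma.mk.injEq, heq_eq_eq, true_and]
    · rw [if_neg fun h => hd (congrArg Sigma.fst h), ← apolar_homogeneousComponent (hhom d i),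
        homogeneousComponent_of_mem (hhom d' j), if_neg hd, ← apolarForm_apply, map_zero]
  have halg : AlgebraicIndependent ℂ f := by
    refine algebraicIndependent_of_finite_type fun t ht => ?_
    have := ht.fintype
    refine algebraicIndependent_of_linearIndependent_mod b W hW _ (fun x => ⟨_, hhom _ _⟩)
      (fun x => hpos _ _) fun c hc x => ?_
    have h : apolar (f x) (∑ y : t, c y • f y) = 0 := hdec _ _ _ hc
    rw [← apolarForm_apply, map_sum, Finset.sum_eq_single x (fun y _ hy => ?_) (by simp)] at h
    · simpa [hforth] using h
    · rw [map_smul, apolarForm_apply, hforth, if_neg fun h => hy (Subtype.ext h.symm), smul_zero]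
  have hgen : Algebra.adjoin ℂ (Set.range f) = invariants b W := by
    refine adjoin_eq_invariants b W f (fun x => (hpos _ _).1) fun d g hg hgd => ?_
    obtain ⟨q, hq, hgq⟩ := hspan d g hg hgd
    exact ⟨q, hq, Submodule.span_mono (by rintro _ ⟨i, rfl⟩; exact ⟨⟨d, i⟩, rfl⟩) hgq⟩
  have hbasis : IsTranscendenceBasis ℂ f := by
    rw [halg.isTranscendenceBasis_iff_isAlgebraic, hgen]
    have := isIntegral_invariants b W
    infer_instance
  obtain ⟨σ⟩ : Nonempty (Fin n ≃ Σ d, Fin (m d)) :=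
    Cardinal.eq.1 ((IsTranscendenceBasis.mvPolynomial (Fin n) ℂ).cardinalMk_eq hbasis)
  refine ⟨f ∘ σ, ⟨fun i => ⟨_, hhom _ _⟩, halg.comp σ σ.injective, ?_⟩, fun i j => ?_⟩
  · rw [σ.surjective.range_comp, hgen]
  · have h : starOp (f (σ i)) (f (σ j)) = C (apolar (f (σ i)) (f (σ j))) :=
      starOp_eq_C_of_orthogonal b W (hpos _ _) (hpos _ _).1 (hdec _ _)
    rw [Function.comp_apply, Function.comp_apply, h, hforth]
    simp only [σ.injective.eq_iff]
    split_ifs <;> simp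

end Canonical

end UnitaryReflection

theorem theorem1 {V : Type*} [NormedAddCommGroup V] [InnerProductSpace ℂ V] {n : ℕ}
    (b : OrthonormalBasis (Fin n) ℂ V) (W : Subgroup (V ≃ₗᵢ[ℂ] V)) [Finite W]
    (hW : UnitaryReflection.IsReflectionGroup W) :
    ∃ f : Fin n → MvPolynomial (Fin n) ℂ, UnitaryReflection.IsCanonicalSystem b W f :=
  UnitaryReflection.exists_isCanonicalSystem b W hW
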